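/- For $k\in\mathbb Z^2$ and $x\in\mathbb R^2$ write $e_k(x)=e^{j2\pi k^Tx}$. A trigonometric polynomial is a finite sum $\psi=\sum_{k} c_k e_k$ with $k\in\mathbb Z^2$, $c_k\in\mathbb C$; these form a ring (complex Laurent polynomials in $e^{j2\pi x_1},e^{j2\pi x_2}$), whose units are the monomials $c\,e_k$, $c\ne0$; irreducibility, divisibility and greatest common divisors are understood in this ring, i.e. up to units. A rectangle of size $k_1\times k_2$ is a set $\{a_1,\dots,a_1+k_1-1\}\times\{a_2,\dots,a_2+k_2-1\}\subset\mathbb Z^2$. The bandwidth of $\psi$ is the smallest rectangle containing all $k$ with $c_k\neq0$. Let $\Lambda\subseteq\Gamma$ be rectangles in $\mathbb Z^2$, with $\Gamma$ of size $l_1\times l_2$, let $\psi\ne0$ be a trigonometric polynomial whose coefficients are supported in $\Lambda$, and let $x_1,\dots,x_N\in\mathbb R^2$ satisfy $\psi(x_i)=0$. Let $\Phi_\Gamma(X)=(e_k(x_i))_{k\in\Gamma,\,1\le i\le N}$ be the feature matrix, and call $\mu=\sum_{k\in\Gamma}c_ke_k$ a null-space function if $c^T\Phi_\Gamma(X)=0$.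 Put $\Gamma:\Lambda=\{l\in\Gamma : l-k\in\Gamma\ \text{for all } k\in\Lambda\}$. Then: 1. $\operatorname{rank}\Phi_\Gamma(X)\le|\Gamma|-|\Gamma:\Lambda|$. 2. $e_l\,\psi$ is a null-space function for every $l\in\mathbb Z^2$ with $l+\Lambda\subseteq\Gamma$. In particular, if $\Lambda=-\Lambda$, then $e_l\,\psi$ is a null-space function for every $l\in\Gamma:\Lambda$. 3. Suppose in addition that $\Lambda$ is the bandwidth of $\psi$, that $\psi=\eta_1\cdots\eta_J$ with $\eta_j$ irreducible and pairwise non-associated, $\eta_j$ having bandwidth of size $k_{1,j}\times k_{2,j}$, that all $x_i\in[0,1)^2$, and that for each $j$ the number $N_j$ of distinct points among the $x_i$ with $\eta_j(x_i)=0$ satisfies $N_j>(l_1+l_2)(k_{1,j}+k_{2,j})$. Then $\psi$ is a greatest common divisor of all null-space functions: it divides each of them, and every common divisor of them divides $\psi$. If moreover $0\in\Lambda$, then $\operatorname{rank}\Phi_\Gamma(X)=|\Gamma|-|\Gamma:\Lambda|$. -/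

import Mathlib

/-- Trigonometric polynomials `ψ(x) = ∑ₖ cₖ exp(j2π kᵀx)` in two variables with frequencies
`k ∈ ℤ²`, given by their finitely supported Fourier coefficients. The product is convolution of
coefficients, i.e. this is the ring of complex Laurent polynomials in `zᵢ = exp(j2π xᵢ)`; its units
are the nonvanishing monomials `c · exp(j2π kᵀx)` with `c ≠ 0`. -/
abbrev TrigPoly : Type := AddMonoidAlgebra ℂ (Fin 2 → ℤ)

namespace TrigPoly

/-- The exponential `exp(j2π kᵀx)` at the point `x`. -/
noncomputable def expAt (k : Fin 2 → ℤ) (x : Fin 2 → ℝ) : ℂ :=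
  Complex.exp (2 * (Real.pi : ℂ) * Complex.I * ∑ i, (k i : ℂ) * (x i : ℂ))

/-- The Fourier coefficient of `ψ` at the frequency `k`. -/
noncomputable def fourierCoeff (ψ : TrigPoly) (k : Fin 2 → ℤ) : ℂ := ψ.coeff k

/-- The set of frequencies at which the Fourier coefficient of `ψ` is nonzero. -/
def freqSupport (ψ : TrigPoly) : Set (Fin 2 → ℤ) := {k | ψ.fourierCoeff k ≠ 0}

/-- The value `ψ(x)`; the sum is finite because `ψ` has finitely many nonzero coefficients. -/
noncomputable def eval (ψ : TrigPoly) (x : Fin 2 → ℝ) : ℂ :=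
  ∑ k ∈ ψ.coeff.support, ψ.fourierCoeff k * expAt k x

/-- The function `exp(j2π kᵀx)` as a trigonometric polynomial. -/
noncomputable def expo (k : Fin 2 → ℤ) : TrigPoly := AddMonoidAlgebra.single k 1

/-- The rectangle in `ℤ²` with lower corner `a` and size `k 0 × k 1`. -/
noncomputable def rect (a : Fin 2 → ℤ) (k : Fin 2 → ℕ) : Finset (Fin 2 → ℤ) :=
  Fintype.piFinset fun i => Finset.Ico (a i) (a i + (k i : ℤ))

/-- `ψ` has bandwidth `Λ`: among the rectangles, `Λ` is the smallest one that contains all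
frequencies of `ψ`. -/
def HasBandwidth (ψ : TrigPoly) (Λ : Finset (Fin 2 → ℤ)) : Prop :=
  (∃ a k, Λ = rect a k) ∧ ψ.freqSupport ⊆ Λ ∧
    ∀ a k, ψ.freqSupport ⊆ rect a k → Λ ⊆ rect a k

/-- `Γ : Λ = {l ∈ Γ : l - k ∈ Γ for all k ∈ Λ}`. -/
def colon (Γ Λ : Finset (Fin 2 → ℤ)) : Finset (Fin 2 → ℤ) :=
  {l ∈ Γ | ∀ k ∈ Λ, l - k ∈ Γ}

/-- The feature matrix `Φ_Γ(X)`, of size `|Γ| × N`: its columns are the feature vectors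
`(exp(j2π kᵀxᵢ))_{k ∈ Γ}` of the points `xᵢ`. -/
noncomputable def featureMatrix (Γ : Finset (Fin 2 → ℤ)) {N : ℕ} (x : Fin N → Fin 2 → ℝ) :
    Matrix Γ (Fin N) ℂ :=
  Matrix.of fun k i => expAt k (x i)

/-- `μ` is a null-space function of `Φ_Γ(X)`: it is band-limited to `Γ`, and its coefficient vector
`c = (cₖ)_{k ∈ Γ}` satisfies the annihilation relation `cᵀ Φ_Γ(X) = 0`. -/
def IsNullFunction (Γ : Finset (Fin 2 → ℤ)) {N : ℕ} (x : Fin N → Fin 2 → ℝ) (μ : TrigPoly) : Prop :=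
  μ.freqSupport ⊆ Γ ∧
    Matrix.vecMul (fun k : Γ => μ.fourierCoeff k) (featureMatrix Γ x) = 0

end TrigPoly

open Module

/-! Null-space functions are the polynomials band-limited to `Γ` that vanish at every sample, so the
rank is `|Γ|` minus the dimension of their space (`rank_featureMatrix_add_finrank_nullSpace`).
Multiplying `ψ` by anything supported on the shifts that carry `Λ` into `Γ` gives such functions,
which bounds the rank from above.

For the converse, suppose an irreducible factor `η` of `ψ` does not divide a null-space function
`μ`. A Bézout bound (`card_common_zeros_le`) then allows fewer common zeros than there are samples
on `η = 0`. That bound is a dimension count: in a large box the combinations `η f + μ g` vanish at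
the common zeros and have small codimension, while evaluation at `n` distinct points of the torus
maps onto `ℂⁿ`. Since the factors are pairwise coprime, `ψ ∣ μ`. Extreme frequencies add under
multiplication (`exists_max_freqSupport_mul`), so the cofactor is supported on the admissible shifts
(`HasBandwidth.mem_band_of_mul_mem`), and the dimension is determined. -/

/-- Trigonometric polynomials in two variables form an iterated Laurent polynomial ring, hence a
unique factorization domain. -/
instance TrigPoly.instUniqueFactorizationMonoid : UniqueFactorizationMonoid TrigPoly := by
  have (R : Type) [CommRing R] [IsDomain R] [UniqueFactorizationMonoid R] :
      UniqueFactorizationMonoid (LaurentPolynomial R) :=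
    UniqueFactorizationMonoid.of_isLocalization (Submonoid.powers (Polynomial.X : Polynomial R)) _
  let e : TrigPoly ≃ₐ[ℂ] LaurentPolynomial (LaurentPolynomial ℂ) :=
    (AddMonoidAlgebra.domCongr ℂ ℂ (LinearEquiv.finTwoArrow ℤ ℤ).toAddEquiv).trans
      (AddMonoidAlgebra.curryAlgEquiv ℂ)
  exact e.symm.toMulEquiv.uniqueFactorizationMonoid inferInstance

namespace TrigPoly

/-! ### Evaluation -/

lemma expAt_zero (x : Fin 2 → ℝ) : expAt 0 x = 1 := by simp [expAt]

lemma expAt_add (k l : Fin 2 → ℤ) (x : Fin 2 → ℝ) :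
    expAt (k + l) x = expAt k x * expAt l x := by
  rw [expAt, expAt, expAt, ← Complex.exp_add, ← mul_add, ← Finset.sum_add_distrib]
  congr 2
  refine Finset.sum_congr rfl fun i _ => ?_
  simp only [Pi.add_apply]
  push_cast
  ring

/-- Evaluation at a point as an algebra homomorphism. -/
noncomputable def evalHom (x : Fin 2 → ℝ) : TrigPoly →ₐ[ℂ] ℂ :=
  AddMonoidAlgebra.lift ℂ ℂ (Fin 2 → ℤ)
    { toFun := fun k => expAt k.toAdd x
      map_one' := expAt_zero x
      map_mul' := fun k l => expAt_add k.toAdd l.toAdd x }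

lemma evalHom_apply (x : Fin 2 → ℝ) (ψ : TrigPoly) : evalHom x ψ = ψ.eval x := by
  rw [evalHom, AddMonoidAlgebra.lift_apply]
  rfl

lemma evalHom_expo (x : Fin 2 → ℝ) (k : Fin 2 → ℤ) : evalHom x (expo k) = expAt k x := by
  simp [evalHom, expo]

/-- Evaluation at a family of points as a linear map. -/
noncomputable def evalFamily {ι : Type*} (y : ι → Fin 2 → ℝ) : TrigPoly →ₗ[ℂ] ι → ℂ :=
  LinearMap.pi fun i => (evalHom (y i)).toLinearMap

lemma evalFamily_apply {ι : Type*} (y : ι → Fin 2 → ℝ) (ψ : TrigPoly) (i : ι) :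
    evalFamily y ψ i = ψ.eval (y i) := evalHom_apply _ _

/-- A coordinate in which the points differ already separates them, because `t ↦ exp(2πit)` is
injective on `[0,1)`. -/
lemma exists_expAt_ne {x y : Fin 2 → ℝ} (hx : ∀ c, x c ∈ Set.Ico (0 : ℝ) 1)
    (hy : ∀ c, y c ∈ Set.Ico (0 : ℝ) 1) (hxy : x ≠ y) : ∃ k, expAt k x ≠ expAt k y := by
  obtain ⟨c, hc⟩ := Function.ne_iff.mp hxy
  refine ⟨Pi.single c 1, fun h => hc ?_⟩
  have hs (z : Fin 2 → ℝ) : ∑ i, ((Pi.single c 1 : Fin 2 → ℤ) i : ℂ) * (z i : ℂ) = z c := by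
    rw [Finset.sum_eq_single c]
    · simp
    · intro b _ hb
      simp [Pi.single_eq_of_ne hb]
    · simp
  rw [expAt, expAt, hs, hs, Complex.exp_eq_exp_iff_exists_int] at h
  obtain ⟨n, hn⟩ := h
  have h2 : (2 * (Real.pi : ℂ) * Complex.I) ≠ 0 := Complex.two_pi_I_ne_zero
  have h3 : (x c : ℂ) = y c + n := mul_left_cancel₀ h2 (by rw [hn]; ring)
  have h4 : x c = y c + n := by exact_mod_cast h3
  have h5 : (n : ℝ) < 1 := by linarith [(hx c).2, (hy c).1]
  have h6 : (-1 : ℝ) < n := by linarith [(hx c).1, (hy c).2]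
  have h7 : n < 1 := by exact_mod_cast h5
  have h8 : -1 < n := by exact_mod_cast h6
  have h9 : n = 0 := by omega
  simpa [h9] using h4

/-- Values of trigonometric polynomials at distinct points of the torus can be prescribed. -/
lemma range_evalFamily {ι : Type*} [Fintype ι] {y : ι → Fin 2 → ℝ} (hinj : Function.Injective y)
    (hy : ∀ i c, y i c ∈ Set.Ico (0 : ℝ) 1) : LinearMap.range (evalFamily y) = ⊤ := by
  classical
  rw [LinearMap.range_eq_top]
  have key (i : ι) : ∃ f : TrigPoly, f.eval (y i) ≠ 0 ∧ ∀ j, j ≠ i → f.eval (y j) = 0 := by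
    have hk (j : ι) : ∃ g : TrigPoly, (j ≠ i → g.eval (y j) = 0 ∧ g.eval (y i) ≠ 0) := by
      by_cases hj : j = i
      · exact ⟨0, fun h => absurd hj h⟩
      obtain ⟨k, hk⟩ := exists_expAt_ne (hy j) (hy i) (hinj.ne hj)
      -- Lagrange interpolation: this factor vanishes at `y j` but not at `y i`; the product over `j
      -- ≠ i` isolates `y i`.
      refine ⟨expo k - algebraMap ℂ TrigPoly (expAt k (y j)), fun _ => ⟨?_, ?_⟩⟩
      · rw [← evalHom_apply, map_sub, evalHom_expo, AlgHom.commutes]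
        simp
      · rw [← evalHom_apply, map_sub, evalHom_expo, AlgHom.commutes]
        simpa [sub_eq_zero] using hk.symm
    choose g hg using hk
    refine ⟨∏ j ∈ Finset.univ.erase i, g j, ?_, fun j hj => ?_⟩
    · rw [← evalHom_apply, map_prod, Finset.prod_ne_zero_iff]
      intro j hj
      rw [evalHom_apply]
      exact (hg j (Finset.ne_of_mem_erase hj)).2
    · rw [← evalHom_apply, map_prod]
      refine Finset.prod_eq_zero (Finset.mem_erase.mpr ⟨hj, Finset.mem_univ j⟩) ?_
      rw [evalHom_apply]
      exact (hg j hj).1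
  choose f hf hf' using key
  intro v
  refine ⟨∑ i, (v i / (f i).eval (y i)) • f i, ?_⟩
  ext j
  rw [map_sum, Finset.sum_apply, Finset.sum_eq_single j]
  · rw [map_smul, Pi.smul_apply, evalFamily_apply, smul_eq_mul, div_mul_cancel₀ _ (hf j)]
  · intro i _ hi
    rw [map_smul, Pi.smul_apply, evalFamily_apply, hf' i j hi.symm, smul_zero]
  · simp

/-! ### Band-limited trigonometric polynomials -/

/-- The space of trigonometric polynomials with frequencies in `S`. -/
noncomputable def band (S : Finset (Fin 2 → ℤ)) : Submodule ℂ TrigPoly :=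
  (Finsupp.supported ℂ ℂ (S : Set (Fin 2 → ℤ))).comap
    (AddMonoidAlgebra.coeffLinearEquiv ℂ).toLinearMap

lemma mem_band {S : Finset (Fin 2 → ℤ)} {f : TrigPoly} : f ∈ band S ↔ f.freqSupport ⊆ S := by
  rw [band, Submodule.mem_comap, Finsupp.mem_supported]
  constructor
  · intro h k hk
    exact h (Finsupp.mem_support_iff.mpr hk)
  · intro h k hk
    exact h (Finsupp.mem_support_iff.mp hk)

lemma mem_freqSupport {f : TrigPoly} {k : Fin 2 → ℤ} :
    k ∈ f.freqSupport ↔ k ∈ f.coeff.support := Finsupp.mem_support_iff.symm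

lemma freqSupport_nonempty {f : TrigPoly} (hf : f ≠ 0) : f.freqSupport.Nonempty := by
  have h : f.coeff ≠ 0 := fun h => hf (AddMonoidAlgebra.coeff_eq_zero.mp h)
  obtain ⟨k, hk⟩ := Finsupp.support_nonempty_iff.mpr h
  exact ⟨k, mem_freqSupport.mpr hk⟩

/-- The coefficients of a band-limited polynomial, indexed by its band. -/
noncomputable def bandEquiv (S : Finset (Fin 2 → ℤ)) : band S ≃ₗ[ℂ] (S → ℂ) :=
  ((AddMonoidAlgebra.coeffLinearEquiv ℂ).ofSubmodule' _).trans
    ((Finsupp.supportedEquivFinsupp (S : Set (Fin 2 → ℤ))).trans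
      (Finsupp.linearEquivFunOnFinite ℂ ℂ _))

instance (S : Finset (Fin 2 → ℤ)) : FiniteDimensional ℂ (band S) :=
  (bandEquiv S).symm.finiteDimensional

lemma finrank_band (S : Finset (Fin 2 → ℤ)) : finrank ℂ (band S) = S.card := by
  rw [(bandEquiv S).finrank_eq, finrank_pi, Fintype.card_coe]

lemma band_mono {S T : Finset (Fin 2 → ℤ)} (h : S ⊆ T) : band S ≤ band T :=
  fun _ hf => mem_band.mpr ((mem_band.mp hf).trans (Finset.coe_subset.mpr h))

lemma exists_add_of_mem_freqSupport_mul {f g : TrigPoly} {m : Fin 2 → ℤ}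
    (hm : m ∈ (f * g).freqSupport) : ∃ p ∈ f.freqSupport, ∃ q ∈ g.freqSupport, p + q = m := by
  classical
  rw [mem_freqSupport, Finsupp.mem_support_iff, AddMonoidAlgebra.coeff_mul] at hm
  obtain ⟨p, hp, hp'⟩ := Finset.exists_ne_zero_of_sum_ne_zero hm
  obtain ⟨q, hq, hq'⟩ := Finset.exists_ne_zero_of_sum_ne_zero hp'
  refine ⟨p, mem_freqSupport.mpr hp, q, mem_freqSupport.mpr hq, ?_⟩
  by_contra h
  exact hq' (if_neg h)

/-- A linear functional on the frequencies is maximized over the support of a product at a sum of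
maximizers over the supports of the factors. -/
lemma exists_max_freqSupport_mul {f g : TrigPoly} (hf : f ≠ 0) (hg : g ≠ 0)
    (φ : (Fin 2 → ℤ) →+ ℤ) :
    ∃ p ∈ f.freqSupport, ∃ q ∈ g.freqSupport, p + q ∈ (f * g).freqSupport ∧
      (∀ r ∈ f.freqSupport, φ r ≤ φ p) ∧ ∀ r ∈ g.freqSupport, φ r ≤ φ q := by
  -- Breaking ties of `φ` lexicographically gives an injective additive map to a linear order. The
  -- maximizers are then unique, so the coefficient at their sum cannot cancel.
  let D : (Fin 2 → ℤ) → ℤ ×ₗ Lex (Fin 2 → ℤ) := fun r => toLex (φ r, toLex r)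
  have hD (r s) : D (r + s) = D r + D s := by
    simp only [D, map_add]
    rfl
  have hDφ {r s} (h : D r ≤ D s) : φ r ≤ φ s := by
    rcases Prod.Lex.le_iff.mp h with h | h
    · exact h.le
    · exact h.1.le
  have hDinj {r s} (h : D r = D s) : r = s := by
    have h1 := congrArg (fun z => (ofLex z).2) h
    exact h1
  obtain ⟨p, hp, hpm⟩ := Finset.exists_max_image f.coeff.support D (by
    obtain ⟨k, hk⟩ := freqSupport_nonempty hf
    exact ⟨k, mem_freqSupport.mp hk⟩)
  obtain ⟨q, hq, hqm⟩ := Finset.exists_max_image g.coeff.support D (by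
    obtain ⟨k, hk⟩ := freqSupport_nonempty hg
    exact ⟨k, mem_freqSupport.mp hk⟩)
  refine ⟨p, mem_freqSupport.mpr hp, q, mem_freqSupport.mpr hq, ?_,
    fun r hr => hDφ (hpm r (mem_freqSupport.mp hr)),
    fun r hr => hDφ (hqm r (mem_freqSupport.mp hr))⟩
  have hu : UniqueAdd f.coeff.support g.coeff.support p q := by
    intro r s hr hs hrs
    have h1 : D r + D s = D p + D q := by rw [← hD, ← hD, hrs]
    have h2 := hpm r hr
    have h3 := hqm s hs
    have h4 := (add_eq_add_iff_eq_and_eq h2 h3).mp h1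
    exact ⟨hDinj h4.1, hDinj h4.2⟩
  rw [mem_freqSupport, Finsupp.mem_support_iff, AddMonoidAlgebra.coeff_mul_add_of_uniqueAdd hu]
  exact mul_ne_zero (Finsupp.mem_support_iff.mp hp) (Finsupp.mem_support_iff.mp hq)

end TrigPoly

namespace TrigPoly

/-! ### Rectangles and bandwidth -/

lemma mem_rect {a : Fin 2 → ℤ} {k : Fin 2 → ℕ} {m : Fin 2 → ℤ} :
    m ∈ rect a k ↔ ∀ i, a i ≤ m i ∧ m i < a i + k i := by
  simp [rect, Fintype.mem_piFinset]

lemma card_rect (a : Fin 2 → ℤ) (k : Fin 2 → ℕ) : (rect a k).card = k 0 * k 1 := by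
  simp [rect, Fintype.card_piFinset, Fin.prod_univ_two]

lemma size_pos_of_mem_rect {a : Fin 2 → ℤ} {k : Fin 2 → ℕ} {m : Fin 2 → ℤ} (h : m ∈ rect a k)
    (i : Fin 2) : 1 ≤ k i := by
  have := mem_rect.mp h i
  omega

/-- The rectangle of the shifts `m` with `m + rect a k ⊆ rect b l`. -/
noncomputable def shiftRect (a : Fin 2 → ℤ) (k : Fin 2 → ℕ) (b : Fin 2 → ℤ) (l : Fin 2 → ℕ) :
    Finset (Fin 2 → ℤ) :=
  rect (fun i => b i - a i) (fun i => l i + 1 - k i)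

lemma mem_shiftRect {a b : Fin 2 → ℤ} {k l : Fin 2 → ℕ} (hk : ∀ i, 1 ≤ k i) {m : Fin 2 → ℤ} :
    m ∈ shiftRect a k b l ↔ ∀ i, b i ≤ m i + a i ∧ m i + a i + k i ≤ b i + l i := by
  rw [shiftRect, mem_rect]
  refine forall_congr' fun i => ?_
  have := hk i
  omega

lemma mul_mem_band {ψ f : TrigPoly} {a b : Fin 2 → ℤ} {k l : Fin 2 → ℕ} (hk : ∀ i, 1 ≤ k i)
    (hψ : ψ ∈ band (rect a k)) (hf : f ∈ band (shiftRect a k b l)) :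
    ψ * f ∈ band (rect b l) := by
  rw [mem_band] at *
  intro m hm
  obtain ⟨p, hp, q, hq, rfl⟩ := exists_add_of_mem_freqSupport_mul hm
  have h1 := mem_rect.mp (Finset.mem_coe.mp (hψ hp))
  have h2 := (mem_shiftRect hk).mp (Finset.mem_coe.mp (hf hq))
  refine Finset.mem_coe.mpr (mem_rect.mpr fun i => ?_)
  have := h1 i
  have := h2 i
  simp only [Pi.add_apply]
  omega

/-- If no frequency touched this side, shaving off one row of lattice points would leave a smaller
rectangle containing the support. -/
lemma HasBandwidth.exists_eq_lower {ψ : TrigPoly} {a : Fin 2 → ℤ} {k : Fin 2 → ℕ}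
    (h : ψ.HasBandwidth (rect a k)) (hψ : ψ ≠ 0) (i : Fin 2) :
    ∃ q ∈ ψ.freqSupport, q i = a i := by
  by_contra! hc
  obtain ⟨q, hq⟩ := freqSupport_nonempty hψ
  have hr : ψ.freqSupport ⊆ rect (Function.update a i (a i + 1)) (Function.update k i (k i - 1)) := by
    intro p hp
    refine Finset.mem_coe.mpr (mem_rect.mpr fun j => ?_)
    have h1 := mem_rect.mp (Finset.mem_coe.mp (h.2.1 hp)) j
    by_cases hj : j = i
    · subst hj
      have h2 := hc p hp
      simp only [Function.update_self]
      omega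
    · simpa [Function.update_of_ne hj] using h1
  have hq' := mem_rect.mp (Finset.mem_coe.mp (h.2.1 hq))
  have h3 : Function.update q i (a i) ∈ rect a k := mem_rect.mpr fun j => by
    have := hq' j
    by_cases hj : j = i
    · subst hj
      simp only [Function.update_self]
      omega
    · simpa [Function.update_of_ne hj] using this
  have h4 := mem_rect.mp (h.2.2 _ _ hr h3) i
  simp only [Function.update_self] at h4
  omega

lemma HasBandwidth.exists_eq_upper {ψ : TrigPoly} {a : Fin 2 → ℤ} {k : Fin 2 → ℕ}
    (h : ψ.HasBandwidth (rect a k)) (hψ : ψ ≠ 0) (i : Fin 2) :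
    ∃ q ∈ ψ.freqSupport, q i + 1 = a i + k i := by
  by_contra! hc
  obtain ⟨q, hq⟩ := freqSupport_nonempty hψ
  have hr : ψ.freqSupport ⊆ rect a (Function.update k i (k i - 1)) := by
    intro p hp
    refine Finset.mem_coe.mpr (mem_rect.mpr fun j => ?_)
    have h1 := mem_rect.mp (Finset.mem_coe.mp (h.2.1 hp)) j
    by_cases hj : j = i
    · subst hj
      have h2 := hc p hp
      simp only [Function.update_self]
      omega
    · simpa [Function.update_of_ne hj] using h1
  have hq' := mem_rect.mp (Finset.mem_coe.mp (h.2.1 hq))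
  have h3 : Function.update q i (a i + k i - 1) ∈ rect a k := mem_rect.mpr fun j => by
    have := hq' j
    by_cases hj : j = i
    · subst hj
      simp only [Function.update_self]
      omega
    · simpa [Function.update_of_ne hj] using this
  have h4 := mem_rect.mp (h.2.2 _ _ hr h3) i
  simp only [Function.update_self] at h4
  omega

/-- The cofactor in a band-limited product is band-limited by the admissible shifts of the
bandwidth of the other factor. -/
lemma HasBandwidth.mem_band_of_mul_mem {ψ f : TrigPoly} {a b : Fin 2 → ℤ} {k l : Fin 2 → ℕ}
    (h : ψ.HasBandwidth (rect a k)) (hψ : ψ ≠ 0) (hm : ψ * f ∈ band (rect b l)) :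
    f ∈ band (shiftRect a k b l) := by
  by_cases hf : f = 0
  · rw [hf]
    exact Submodule.zero_mem _
  have hk : ∀ i, 1 ≤ k i := by
    obtain ⟨q, hq⟩ := freqSupport_nonempty hψ
    exact size_pos_of_mem_rect (Finset.mem_coe.mp (h.2.1 hq))
  rw [mem_band] at hm ⊢
  intro r hr
  refine Finset.mem_coe.mpr ((mem_shiftRect hk).mpr fun i => ?_)
  let φ : (Fin 2 → ℤ) →+ ℤ := Pi.evalAddMonoidHom (fun _ => ℤ) i
  have hφ (s) : φ s = s i := rfl
  constructor
  -- The least `i`-th coordinate of the product is the sum of those of the factors, and that of `ψ`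
  -- is `a i`.
  · obtain ⟨p, hp, q, hq, hpq, h1, h2⟩ := exists_max_freqSupport_mul hψ hf (-φ)
    obtain ⟨s, hs, hs'⟩ := h.exists_eq_lower hψ i
    have h3 := (mem_rect.mp (Finset.mem_coe.mp (hm hpq)) i).1
    have h4 := h1 s hs
    have h5 := h2 r hr
    simp only [AddMonoidHom.neg_apply, hφ, Pi.add_apply] at h3 h4 h5
    omega
  · obtain ⟨p, hp, q, hq, hpq, h1, h2⟩ := exists_max_freqSupport_mul hψ hf φ
    obtain ⟨s, hs, hs'⟩ := h.exists_eq_upper hψ i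
    have h3 := (mem_rect.mp (Finset.mem_coe.mp (hm hpq)) i).2
    have h4 := h1 s hs
    have h5 := h2 r hr
    simp only [hφ, Pi.add_apply] at h3 h4 h5
    omega

lemma exists_finset_subset_rect (s : Finset (Fin 2 → ℤ)) (n : ℕ) :
    ∃ M : ℕ, n ≤ M ∧ s ⊆ rect (fun _ => -(M : ℤ)) (fun _ => M + M + 1) := by
  classical
  induction s using Finset.induction_on with
  | empty => exact ⟨n, le_rfl, by simp⟩
  | insert m s _ ih =>
    obtain ⟨M, hM, hs⟩ := ih
    refine ⟨M + (m 0).natAbs + (m 1).natAbs, by omega, ?_⟩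
    rw [Finset.insert_subset_iff]
    refine ⟨mem_rect.mpr (Fin.forall_fin_two.mpr ⟨?_, ?_⟩), fun q hq => mem_rect.mpr fun i => ?_⟩
    · push_cast [-Int.natCast_natAbs]
      omega
    · push_cast [-Int.natCast_natAbs]
      omega
    · have := mem_rect.mp (hs hq) i
      push_cast [-Int.natCast_natAbs] at this ⊢
      omega

/-! ### Counting common zeros -/

/-- Multiplication by a fixed trigonometric polynomial. -/
noncomputable abbrev mulLeft (ψ : TrigPoly) : TrigPoly →ₗ[ℂ] TrigPoly := LinearMap.mulLeft ℂ ψ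

lemma mulLeft_injective {ψ : TrigPoly} (hψ : ψ ≠ 0) : Function.Injective (mulLeft ψ) :=
  fun _ _ h => mul_left_cancel₀ hψ h

lemma card_shiftRect (a b : Fin 2 → ℤ) (k l : Fin 2 → ℕ) :
    (shiftRect a k b l).card = (l 0 + 1 - k 0) * (l 1 + 1 - k 1) := card_rect _ _

/-- A Bézout bound: the number of common zeros on the torus of a prime trigonometric polynomial
and one that it does not divide. -/
theorem card_common_zeros_le {A B : TrigPoly} {a b : Fin 2 → ℤ} {k l : Fin 2 → ℕ}
    (hA : Prime A) (hAB : ¬ A ∣ B) (hAk : A.HasBandwidth (rect a k))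
    (hB : B ∈ band (rect b l)) {ι : Type*} [Fintype ι] {y : ι → Fin 2 → ℝ}
    (hinj : Function.Injective y) (hy : ∀ i c, y i c ∈ Set.Ico (0 : ℝ) 1)
    (hyA : ∀ i, A.eval (y i) = 0) (hyB : ∀ i, B.eval (y i) = 0) :
    Fintype.card ι ≤ (k 0 - 1) * (l 1 - 1) + (k 1 - 1) * (l 0 - 1) := by
  classical
  have hB0 : B ≠ 0 := fun h => hAB (h ▸ dvd_zero A)
  have hk : ∀ i, 1 ≤ k i := by
    obtain ⟨q, hq⟩ := freqSupport_nonempty hA.ne_zero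
    exact size_pos_of_mem_rect (Finset.mem_coe.mp (hAk.2.1 hq))
  have hl : ∀ i, 1 ≤ l i := by
    obtain ⟨q, hq⟩ := freqSupport_nonempty hB0
    exact size_pos_of_mem_rect (Finset.mem_coe.mp (mem_band.mp hB hq))
  obtain ⟨g, hg⟩ : ∃ g : (ι → ℂ) → TrigPoly, ∀ v, evalFamily y (g v) = v :=
    ⟨_, Function.surjInv_eq (LinearMap.range_eq_top.mp (range_evalFamily hinj hy))⟩
  -- The box must hold a set of interpolating polynomials, so that evaluation stays onto, and must
  -- exceed both bandwidths, so that the natural-number subtractions below are exact.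
  obtain ⟨M, hM, hMs⟩ := exists_finset_subset_rect
    (Finset.univ.biUnion fun i : ι => (g (Pi.single i 1)).coeff.support)
    (k 0 + k 1 + l 0 + l 1)
  set c : Fin 2 → ℤ := fun _ => -(M : ℤ) with hc
  set L : Fin 2 → ℕ := fun _ => M + M + 1 with hL
  have htop : LinearMap.range ((evalFamily y).domRestrict (band (rect c L))) = ⊤ := by
    rw [eq_top_iff]
    intro v _
    have hgm (i : ι) : g (Pi.single i 1) ∈ band (rect c L) := mem_band.mpr fun m hm =>
      Finset.mem_coe.mpr
        (hMs (Finset.mem_biUnion.mpr ⟨i, Finset.mem_univ i, mem_freqSupport.mp hm⟩))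
    refine ⟨∑ i, v i • ⟨g (Pi.single i 1), hgm i⟩, ?_⟩
    rw [map_sum]
    simp only [map_smul, LinearMap.domRestrict_apply, hg]
    ext j
    simp [Finset.sum_apply, Pi.single_apply]
  have hrank := LinearMap.finrank_range_add_finrank_ker
    ((evalFamily y).domRestrict (band (rect c L)))
  rw [htop, finrank_top, finrank_pi, finrank_band, card_rect] at hrank
  let T : band (shiftRect a k c L) × band (shiftRect b l c L) →ₗ[ℂ] TrigPoly :=
    ((mulLeft A).domRestrict _).coprod ((mulLeft B).domRestrict _)
  have hT (p) : T p = A * p.1 + B * p.2 := rfl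
  have hTrank := LinearMap.finrank_range_add_finrank_ker T
  rw [finrank_prod, finrank_band, finrank_band] at hTrank
  have hrange : finrank ℂ (LinearMap.range T) ≤
      finrank ℂ (LinearMap.ker ((evalFamily y).domRestrict (band (rect c L)))) := by
    rw [← Submodule.finrank_map_subtype_eq]
    refine Submodule.finrank_mono ?_
    rintro _ ⟨p, rfl⟩
    refine ⟨⟨T p, ?_⟩, ?_, rfl⟩
    · exact Submodule.add_mem _
        (mul_mem_band hk (mem_band.mpr hAk.2.1) p.1.2) (mul_mem_band hl hB p.2.2)
    · simp only [SetLike.mem_coe, LinearMap.mem_ker, LinearMap.domRestrict_apply]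
      ext i
      rw [evalFamily_apply, hT, ← evalHom_apply, map_add, map_mul, map_mul, evalHom_apply _ A,
        evalHom_apply _ B, hyA, hyB]
      simp
  -- Syzygies: `A f + B f' = 0` with `A` prime and `A ∤ B` forces `f' = A h`, and `f'` determines
  -- `f`. The bandwidth of `A` confines `h` to the shifts admissible for both factors.
  have hker : finrank ℂ (LinearMap.ker T) ≤
      (shiftRect a k (fun i => c i - b i) (fun i => L i + 1 - l i)).card := by
    let S : LinearMap.ker T →ₗ[ℂ] TrigPoly :=
      (band (shiftRect b l c L)).subtype ∘ₗ LinearMap.snd ℂ _ _ ∘ₗ (LinearMap.ker T).subtype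
    have hS : Function.Injective S := by
      rw [injective_iff_map_eq_zero]
      rintro ⟨⟨f, f'⟩, hf⟩ h
      have h1 : (f' : TrigPoly) = 0 := h
      have h2 : A * (f : TrigPoly) + B * f' = 0 := hf
      rw [h1, mul_zero, add_zero] at h2
      have h3 : (f : TrigPoly) = 0 := (mul_eq_zero.mp h2).resolve_left hA.ne_zero
      exact Subtype.ext (Prod.ext (Subtype.ext h3) (Subtype.ext h1))
    rw [← LinearMap.finrank_range_of_inj hS, ← finrank_band]
    refine (Submodule.finrank_mono ?_).trans (Submodule.finrank_map_le (mulLeft A) _)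
    rintro _ ⟨⟨⟨f, f'⟩, hf⟩, rfl⟩
    have h2 : A * (f : TrigPoly) + B * f' = 0 := hf
    have h3 : A ∣ B * f' := ⟨-f, by linear_combination h2⟩
    obtain ⟨h, hh⟩ := (hA.dvd_or_dvd h3).resolve_left hAB
    refine ⟨h, hAk.mem_band_of_mul_mem hA.ne_zero ?_, hh.symm⟩
    rw [← hh]
    exact f'.2
  rw [card_shiftRect] at hTrank hker
  rw [card_shiftRect] at hTrank
  -- With `L = t + p + r` the count is `L₀L₁ - (t₀+r₀)(t₁+r₁) - (t₀+p₀)(t₁+p₁) + t₀t₁ = p₀r₁ +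
  -- p₁r₀`.
  obtain ⟨p, hp⟩ : ∃ p : Fin 2 → ℕ, ∀ i, k i = p i + 1 :=
    ⟨fun i => k i - 1, fun i => by have := hk i; dsimp only; omega⟩
  obtain ⟨r, hr⟩ : ∃ r : Fin 2 → ℕ, ∀ i, l i = r i + 1 :=
    ⟨fun i => l i - 1, fun i => by have := hl i; dsimp only; omega⟩
  obtain ⟨t, ht⟩ : ∃ t : Fin 2 → ℕ, ∀ i, L i = t i + p i + r i := by
    refine ⟨fun i => L i - p i - r i, Fin.forall_fin_two.mpr ⟨?_, ?_⟩⟩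
    all_goals
      have := hp 0
      have := hp 1
      have := hr 0
      have := hr 1
      simp only [hL]
      omega
  have e1 (i) : L i + 1 - k i = t i + r i := by have := hp i; have := ht i; omega
  have e2 (i) : L i + 1 - l i = t i + p i := by have := hr i; have := ht i; omega
  have e3 (i) : t i + p i + 1 - k i = t i := by have := hp i; omega
  simp only [e1, e2, e3] at hTrank hker
  clear_value L
  simp only [ht] at hrank
  simp only [hp, hr, Nat.add_sub_cancel]
  nlinarith

end TrigPoly

namespace TrigPoly

/-! ### The null space of the feature matrix -/

variable {N : ℕ}

/-- The space of null-space functions of the feature matrix. -/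
noncomputable def nullSpace (Γ : Finset (Fin 2 → ℤ)) (x : Fin N → Fin 2 → ℝ) :
    Submodule ℂ TrigPoly := band Γ ⊓ LinearMap.ker (evalFamily x)

lemma eval_eq_sum_of_mem_band {Γ : Finset (Fin 2 → ℤ)} {μ : TrigPoly} (hμ : μ ∈ band Γ)
    (y : Fin 2 → ℝ) : μ.eval y = ∑ k : Γ, μ.fourierCoeff k * expAt k y := by
  rw [Finset.sum_coe_sort Γ fun k => μ.fourierCoeff k * expAt k y]
  refine Finset.sum_subset (fun k hk => mem_band.mp hμ (mem_freqSupport.mpr hk)) fun k _ hk => ?_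
  rw [fourierCoeff, Finsupp.notMem_support_iff.mp hk, zero_mul]

lemma evalFamily_eq_vecMul {Γ : Finset (Fin 2 → ℤ)} (x : Fin N → Fin 2 → ℝ) {μ : TrigPoly}
    (hμ : μ ∈ band Γ) : evalFamily x μ =
      Matrix.vecMul (fun k : Γ => μ.fourierCoeff k) (featureMatrix Γ x) := by
  ext i
  rw [evalFamily_apply, eval_eq_sum_of_mem_band hμ]
  rfl

lemma mem_nullSpace {Γ : Finset (Fin 2 → ℤ)} {x : Fin N → Fin 2 → ℝ} {μ : TrigPoly} :
    μ ∈ nullSpace Γ x ↔ IsNullFunction Γ x μ := by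
  rw [nullSpace, Submodule.mem_inf, IsNullFunction, ← mem_band, LinearMap.mem_ker]
  exact and_congr_right fun h => by rw [evalFamily_eq_vecMul x h]

lemma mem_nullSpace_iff_eval {Γ : Finset (Fin 2 → ℤ)} {x : Fin N → Fin 2 → ℝ} {μ : TrigPoly} :
    μ ∈ nullSpace Γ x ↔ μ ∈ band Γ ∧ ∀ i, μ.eval (x i) = 0 := by
  rw [nullSpace, Submodule.mem_inf, LinearMap.mem_ker]
  refine and_congr_right fun _ => ⟨fun h i => ?_, fun h => ?_⟩
  · rw [← evalFamily_apply, h, Pi.zero_apply]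
  · ext i
    rw [evalFamily_apply, h, Pi.zero_apply]

instance (Γ : Finset (Fin 2 → ℤ)) (x : Fin N → Fin 2 → ℝ) :
    FiniteDimensional ℂ (nullSpace Γ x) :=
  Submodule.finiteDimensional_of_le (inf_le_left : nullSpace Γ x ≤ band Γ)

/-- Rank-nullity for evaluation on `band Γ`, whose matrix in coefficient coordinates is the
transposed feature matrix. -/
theorem rank_featureMatrix_add_finrank_nullSpace (Γ : Finset (Fin 2 → ℤ))
    (x : Fin N → Fin 2 → ℝ) :
    (featureMatrix Γ x).rank + finrank ℂ (nullSpace Γ x) = Γ.card := by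
  have hcomp : (evalFamily x).domRestrict (band Γ) =
      (featureMatrix Γ x).transpose.mulVecLin ∘ₗ (bandEquiv Γ).toLinearMap := by
    ext1 μ
    rw [LinearMap.domRestrict_apply, evalFamily_eq_vecMul x μ.2, LinearMap.comp_apply,
      Matrix.mulVecLin_apply, Matrix.mulVec_transpose]
    rfl
  have hrange : (featureMatrix Γ x).rank =
      finrank ℂ (LinearMap.range ((evalFamily x).domRestrict (band Γ))) := by
    rw [hcomp, LinearMap.range_comp, LinearEquiv.range, Submodule.map_top, ← Matrix.rank_transpose]
    rfl
  have hker : finrank ℂ (nullSpace Γ x) =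
      finrank ℂ (LinearMap.ker ((evalFamily x).domRestrict (band Γ))) := by
    rw [← Submodule.finrank_map_subtype_eq, LinearMap.ker_domRestrict,
      Submodule.map_comap_subtype, nullSpace]
  rw [hrange, hker, LinearMap.finrank_range_add_finrank_ker, finrank_band]

/-- The `m` with `m - rect a k ⊆ rect b l` form a rectangle. -/
lemma forall_sub_mem_rect_iff {a b : Fin 2 → ℤ} {k l : Fin 2 → ℕ} (hk : ∀ i, 1 ≤ k i)
    {m : Fin 2 → ℤ} : (∀ q ∈ rect a k, m - q ∈ rect b l) ↔
      m ∈ rect (fun i => b i + a i + k i - 1) (fun i => l i + 1 - k i) := by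
  constructor
  · intro h
    have h1 := mem_rect.mp (h a (mem_rect.mpr fun j => by have := hk j; omega))
    have h2 := mem_rect.mp (h (fun j => a j + k j - 1)
      (mem_rect.mpr fun j => by have := hk j; omega))
    refine mem_rect.mpr fun i => ?_
    have := h1 i
    have := h2 i
    simp only [Pi.sub_apply] at *
    omega
  · intro h q hq
    refine mem_rect.mpr fun i => ?_
    have := mem_rect.mp h i
    have := mem_rect.mp hq i
    simp only [Pi.sub_apply] at *
    omega

/-- The colon uses `m - Λ` where products use `m + Λ`; the two shift rectangles have equal size.
Only an inequality results, since the colon also demands `m ∈ Γ`. -/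
lemma card_colon_le {a b : Fin 2 → ℤ} {k l : Fin 2 → ℕ} (hk : ∀ i, 1 ≤ k i) :
    (colon (rect b l) (rect a k)).card ≤ (shiftRect a k b l).card := by
  rw [shiftRect, card_rect, ← card_rect (fun i => b i + a i + k i - 1) fun i => l i + 1 - k i]
  exact Finset.card_le_card fun m hm =>
    (forall_sub_mem_rect_iff hk).mp (Finset.mem_filter.mp hm).2

/-- With `0 ∈ Λ`, the extra demand `m ∈ Γ` is the case `m - 0 ∈ Γ`. -/
lemma card_colon_eq {a b : Fin 2 → ℤ} {k l : Fin 2 → ℕ} (h0 : 0 ∈ rect a k) :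
    (colon (rect b l) (rect a k)).card = (shiftRect a k b l).card := by
  have hk := size_pos_of_mem_rect h0
  refine (card_colon_le hk).antisymm ?_
  rw [shiftRect, card_rect, ← card_rect (fun i => b i + a i + k i - 1) fun i => l i + 1 - k i]
  refine Finset.card_le_card fun m hm => ?_
  have h := (forall_sub_mem_rect_iff hk).mpr hm
  exact Finset.mem_filter.mpr ⟨by simpa using h 0 h0, h⟩

lemma mul_mem_nullSpace {ψ f : TrigPoly} {Γ : Finset (Fin 2 → ℤ)} {x : Fin N → Fin 2 → ℝ}
    (hx : ∀ i, ψ.eval (x i) = 0) (h : ψ * f ∈ band Γ) : ψ * f ∈ nullSpace Γ x := by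
  refine mem_nullSpace_iff_eval.mpr ⟨h, fun i => ?_⟩
  rw [← evalHom_apply, map_mul, evalHom_apply, hx, zero_mul]

lemma expo_mul_mem_band {ψ : TrigPoly} {Λ Γ : Finset (Fin 2 → ℤ)} (hψ : ψ ∈ band Λ)
    {m : Fin 2 → ℤ} (hm : ∀ q ∈ Λ, m + q ∈ Γ) : ψ * expo m ∈ band Γ := by
  classical
  refine mem_band.mpr fun r hr => ?_
  obtain ⟨p, hp, q, hq, rfl⟩ := exists_add_of_mem_freqSupport_mul hr
  have hqm : q = m := by
    by_contra h
    exact hq (by rw [fourierCoeff, expo, AddMonoidAlgebra.coeff_single,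
      Finsupp.single_apply, if_neg (Ne.symm h)])
  rw [hqm, add_comm]
  exact Finset.mem_coe.mpr (hm p (Finset.mem_coe.mp (mem_band.mp hψ hp)))

lemma card_shiftRect_le_finrank_nullSpace {ψ : TrigPoly} (hψ : ψ ≠ 0) {a b : Fin 2 → ℤ}
    {k l : Fin 2 → ℕ} (hk : ∀ i, 1 ≤ k i) (hψk : ψ ∈ band (rect a k))
    {x : Fin N → Fin 2 → ℝ} (hx : ∀ i, ψ.eval (x i) = 0) :
    (shiftRect a k b l).card ≤ finrank ℂ (nullSpace (rect b l) x) := by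
  have hinj : Function.Injective ((mulLeft ψ).domRestrict (band (shiftRect a k b l))) :=
    (mulLeft_injective hψ).comp Subtype.val_injective
  rw [← finrank_band, ← LinearMap.finrank_range_of_inj hinj]
  refine Submodule.finrank_mono ?_
  rintro _ ⟨f, rfl⟩
  exact mul_mem_nullSpace hx (mul_mem_band hk hψk f.2)

lemma finrank_nullSpace_le {ψ : TrigPoly} (hψ : ψ ≠ 0) {a b : Fin 2 → ℤ} {k l : Fin 2 → ℕ}
    (hψk : ψ.HasBandwidth (rect a k)) {x : Fin N → Fin 2 → ℝ}
    (hdvd : ∀ μ ∈ nullSpace (rect b l) x, ψ ∣ μ) :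
    finrank ℂ (nullSpace (rect b l) x) ≤ (shiftRect a k b l).card := by
  rw [← finrank_band]
  refine (Submodule.finrank_mono ?_).trans (Submodule.finrank_map_le (mulLeft ψ) _)
  intro μ hμ
  obtain ⟨f, rfl⟩ := hdvd μ hμ
  exact ⟨f, hψk.mem_band_of_mul_mem hψ (mem_nullSpace_iff_eval.mp hμ).1, rfl⟩

/-- An irreducible trigonometric polynomial divides every null-space function as soon as
sufficiently many sampling points lie on its zero set. -/
lemma dvd_of_mem_nullSpace {η μ : TrigPoly} (hη : Irreducible η) {a b : Fin 2 → ℤ}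
    {k l : Fin 2 → ℕ} (hηk : η.HasBandwidth (rect a k)) {x : Fin N → Fin 2 → ℝ}
    (hx : ∀ i c, x i c ∈ Set.Ico (0 : ℝ) 1)
    (hcard : (l 0 + l 1) * (k 0 + k 1) <
      {p : Fin 2 → ℝ | p ∈ Set.range x ∧ η.eval p = 0}.ncard)
    (hμ : μ ∈ nullSpace (rect b l) x) : η ∣ μ := by
  by_contra hdvd
  -- Working with the set of values discards repeated samples, as the Bézout bound needs distinct
  -- points.
  set S := {p : Fin 2 → ℝ | p ∈ Set.range x ∧ η.eval p = 0}
  have hfin : S.Finite := (Set.finite_range x).subset fun p hp => hp.1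
  have := hfin.fintype
  obtain ⟨hμb, hμx⟩ := mem_nullSpace_iff_eval.mp hμ
  have hle := card_common_zeros_le hη.prime hdvd hηk hμb (ι := S) (y := Subtype.val)
    Subtype.val_injective
    (by rintro ⟨_, ⟨i, rfl⟩, _⟩ c; exact hx i c) (fun p => p.2.2)
    (by rintro ⟨_, ⟨i, rfl⟩, _⟩; exact hμx i)
  rw [← Nat.card_eq_fintype_card, Nat.card_coe_set_eq] at hle
  have h1 : (k 0 - 1) * (l 1 - 1) ≤ k 0 * l 1 :=
    Nat.mul_le_mul (Nat.sub_le _ _) (Nat.sub_le _ _)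
  have h2 : (k 1 - 1) * (l 0 - 1) ≤ k 1 * l 0 :=
    Nat.mul_le_mul (Nat.sub_le _ _) (Nat.sub_le _ _)
  have h3 : 0 ≤ l 0 * k 0 + l 1 * k 1 := Nat.zero_le _
  nlinarith

end TrigPoly

theorem proposition5
    (ψ : TrigPoly) (hψ : ψ ≠ 0)
    (Λ Γ : Finset (Fin 2 → ℤ)) (a b : Fin 2 → ℤ) (k l : Fin 2 → ℕ)
    (hΛ : Λ = TrigPoly.rect a k) (hΓ : Γ = TrigPoly.rect b l) (hΛΓ : Λ ⊆ Γ)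
    (hsupp : ψ.freqSupport ⊆ Λ)
    (N : ℕ) (x : Fin N → Fin 2 → ℝ) (hx : ∀ i, ψ.eval (x i) = 0) :
    -- the rank bound
    (TrigPoly.featureMatrix Γ x).rank ≤ Γ.card - (TrigPoly.colon Γ Λ).card ∧
    -- the shifted filters lie in the null space
    (∀ m : Fin 2 → ℤ, (∀ q ∈ Λ, m + q ∈ Γ) →
      TrigPoly.IsNullFunction Γ x (TrigPoly.expo m * ψ)) ∧
    ((∀ q ∈ Λ, -q ∈ Λ) → ∀ m ∈ TrigPoly.colon Γ Λ,
      TrigPoly.IsNullFunction Γ x (TrigPoly.expo m * ψ)) ∧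
    -- under the sampling conditions: equality, and `ψ` is the greatest common divisor
    (∀ (J : ℕ) (η : Fin J → TrigPoly) (a' : Fin J → Fin 2 → ℤ) (k' : Fin J → Fin 2 → ℕ),
      ψ.HasBandwidth Λ →
      ψ = ∏ j, η j →
      (∀ j, Irreducible (η j)) →
      (∀ i j, i ≠ j → ¬ Associated (η i) (η j)) →
      (∀ j, (η j).HasBandwidth (TrigPoly.rect (a' j) (k' j))) →
      (∀ i c, x i c ∈ Set.Ico (0 : ℝ) 1) →
      (∀ j, (l 0 + l 1) * (k' j 0 + k' j 1) <
        {p : Fin 2 → ℝ | p ∈ Set.range x ∧ (η j).eval p = 0}.ncard) →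
      (0 ∈ Λ →
        (TrigPoly.featureMatrix Γ x).rank = Γ.card - (TrigPoly.colon Γ Λ).card) ∧
      (∀ μ, TrigPoly.IsNullFunction Γ x μ → ψ ∣ μ) ∧
      (∀ d : TrigPoly, (∀ μ, TrigPoly.IsNullFunction Γ x μ → d ∣ μ) → d ∣ ψ)) := by
  subst hΛ hΓ
  have hk : ∀ i, 1 ≤ k i := by
    obtain ⟨q, hq⟩ := TrigPoly.freqSupport_nonempty hψ
    exact TrigPoly.size_pos_of_mem_rect (Finset.mem_coe.mp (hsupp hq))
  have hψb : ψ ∈ TrigPoly.band (TrigPoly.rect a k) := TrigPoly.mem_band.mpr hsupp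
  have hrank := TrigPoly.rank_featureMatrix_add_finrank_nullSpace (TrigPoly.rect b l) x
  have hshift (m : Fin 2 → ℤ) (hm : ∀ q ∈ TrigPoly.rect a k, m + q ∈ TrigPoly.rect b l) :
      TrigPoly.IsNullFunction (TrigPoly.rect b l) x (TrigPoly.expo m * ψ) := by
    rw [mul_comm, ← TrigPoly.mem_nullSpace]
    exact TrigPoly.mul_mem_nullSpace hx (TrigPoly.expo_mul_mem_band hψb hm)
  refine ⟨?_, hshift, fun hsymm m hm => hshift m fun q hq => ?_, ?_⟩
  · have h1 := TrigPoly.card_shiftRect_le_finrank_nullSpace (b := b) (l := l) hψ hk hψb hx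
    have h2 := TrigPoly.card_colon_le (a := a) (b := b) (l := l) hk
    omega
  -- Symmetry of `Λ` turns `m - (-q) ∈ Γ` into `m + q ∈ Γ`.
  · simpa using (Finset.mem_filter.mp hm).2 (-q) (hsymm q hq)
  · intro J η a' k' hbw hprod hirr hassoc hηbw hx01 hcard
    have hdvd : ∀ μ ∈ TrigPoly.nullSpace (TrigPoly.rect b l) x, ψ ∣ μ := by
      intro μ hμ
      rw [hprod]
      refine Finset.prod_dvd_of_isRelPrime (fun i _ j _ hij => ?_) fun j _ =>
        TrigPoly.dvd_of_mem_nullSpace (hirr j) (hηbw j) hx01 (hcard j) hμ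
      exact (hirr i).isRelPrime_iff_not_dvd.mpr fun h =>
        hassoc i j hij ((hirr i).associated_of_dvd (hirr j) h)
    refine ⟨fun h0 => ?_, fun μ hμ => hdvd μ (TrigPoly.mem_nullSpace.mpr hμ), fun d hd => ?_⟩
    · have h1 := TrigPoly.card_shiftRect_le_finrank_nullSpace (b := b) (l := l) hψ hk hψb hx
      have h2 := TrigPoly.finrank_nullSpace_le hψ hbw hdvd
      have h3 := TrigPoly.card_colon_eq (b := b) (l := l) h0
      omega
    -- As `Λ ⊆ Γ`, `ψ` is itself a null-space function, so every common divisor divides it.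
    · exact hd ψ (TrigPoly.mem_nullSpace.mp (TrigPoly.mem_nullSpace_iff_eval.mpr
        ⟨TrigPoly.band_mono hΛΓ hψb, hx⟩))
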